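/- For every constant $K>0$ there are constants $\varepsilon_0>0$ and $c>0$, depending only on $K$, such that the following holds for all $n,m,d\in\mathbb N$ and all real $\alpha\ge 1$, $\varepsilon>0$ with $\varepsilon\le\varepsilon_0\alpha$ and $d\ge n\alpha/\varepsilon$. Let $\mathcal S$ be a probability distribution over real $m\times d$ matrices which is non-dilating with constant $K$, i.e. $\Pr_{S\sim\mathcal S}[\|SV\|_2\le K]\ge 99/100$ for every $V\in\mathbb R^{d\times n}$ with $V^{\mathsf T}V=I_n$ (where $\|\cdot\|_2$ is the spectral norm of a matrix and the Euclidean norm of a vector). Suppose that for every $A\in\mathbb R^{n\times d}$, $b\in\mathbb R^n$ and $\lambda>0$ with $1\le\|A\|_2^2/\lambda\le\alpha$, the vector $\tilde x=A^{\mathsf T}(AS^{\mathsf T}SA^{\mathsf T}+\lambda I_n)^{-1}b$ satisfies $$\Pr_{S\sim\mathcal S}\Big[\|A\tilde x-b\|_2^2+\lambda\|\tilde x\|_2^2\le(1+\varepsilon)\min_{x\in\mathbb R^d}\big(\|Ax-b\|_2^2+\lambda\|x\|_2^2\big)\Big]\ge 0.99 .$$ Then $m\ge c\,n\alpha/\varepsilon$;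 in particular $m\ge c\,n\sigma^2/(\lambda\varepsilon)$ for every $A\in\mathbb R^{n\times d}$ and $\lambda>0$ with $\sigma=\|A\|_2$ and $1\le\sigma^2/\lambda\le\alpha$. -/

import Mathlib

open MeasureTheory
open scoped Matrix

namespace RidgeSketch

noncomputable section

/-- The product (entrywise Borel) σ-algebra on real matrices. -/
instance instMeasurableSpaceMatrix (p q : ℕ) : MeasurableSpace (Matrix (Fin p) (Fin q) ℝ) :=
  inferInstanceAs (MeasurableSpace (Fin p → Fin q → ℝ))

/-- The spectral norm of a real matrix, i.e. its operator norm between Euclidean spaces. -/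
def specNorm {p q : ℕ} (M : Matrix (Fin p) (Fin q) ℝ) : ℝ :=
  ‖LinearMap.toContinuousLinearMap (Matrix.toEuclideanLin M)‖

/-- The ridge regression objective `‖A x - b‖² + lam ‖x‖²` (Euclidean norms). -/
def cost {n d : ℕ} (A : Matrix (Fin n) (Fin d) ℝ) (b : EuclideanSpace ℝ (Fin n)) (lam : ℝ)
    (x : EuclideanSpace ℝ (Fin d)) : ℝ :=
  ‖Matrix.toEuclideanLin A x - b‖ ^ 2 + lam * ‖x‖ ^ 2

/-- The optimal value of the ridge regression problem. -/
def opt {n d : ℕ} (A : Matrix (Fin n) (Fin d) ℝ) (b : EuclideanSpace ℝ (Fin n)) (lam : ℝ) : ℝ :=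
  ⨅ x : EuclideanSpace ℝ (Fin d), cost A b lam x

/-- The sketched solution `Aᵀ (A Sᵀ S Aᵀ + lam I)⁻¹ b`. -/
def sketchedSol {m n d : ℕ} (S : Matrix (Fin m) (Fin d) ℝ) (A : Matrix (Fin n) (Fin d) ℝ)
    (b : EuclideanSpace ℝ (Fin n)) (lam : ℝ) : EuclideanSpace ℝ (Fin d) :=
  Matrix.toEuclideanLin (Aᵀ * (A * Sᵀ * S * Aᵀ + lam • (1 : Matrix (Fin n) (Fin n) ℝ))⁻¹) b

/-- A distribution over `m × d` matrices is non-dilating (for `d × n` matrices, with constant `K`)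
if for every `d × n` matrix `V` with orthonormal columns, `‖S V‖ ≤ K` with probability at
least `99/100`. -/
def NonDilating {m d : ℕ} (n : ℕ) (K : ℝ) (μ : Measure (Matrix (Fin m) (Fin d) ℝ)) : Prop :=
  ∀ V : Matrix (Fin d) (Fin n) ℝ, Vᵀ * V = 1 →
    (99 / 100 : ℝ) ≤ μ.real {S | specNorm (S * V) ≤ K}

/-- For every ridge regression instance with an `n × d` design matrix and
`1 ≤ ‖A‖² / lam ≤ α`, the sketched solution is a `(1 + ε)`-approximation with probability at
least `99/100`. -/
def SolvesRidge {m d : ℕ} (n : ℕ) (α ε : ℝ) (μ : Measure (Matrix (Fin m) (Fin d) ℝ)) : Prop :=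
  ∀ (A : Matrix (Fin n) (Fin d) ℝ) (b : EuclideanSpace ℝ (Fin n)) (lam : ℝ), 0 < lam →
    1 ≤ specNorm A ^ 2 / lam → specNorm A ^ 2 / lam ≤ α →
    (99 / 100 : ℝ) ≤
      μ.real {S | cost A b lam (sketchedSol S A b lam) ≤ (1 + ε) * opt A b lam}

end

end RidgeSketch

/-!
The ridge guarantee is tested on `A = √α Vᵀ` with `Vᵀ V = 1`, `lam = 1` and `b` a basis vector.
There the excess cost has a closed form, and together with `‖S V‖ ≤ K` it forces
`‖(Vᵀ Sᵀ S V - 1) b‖² ≤ η := (K² + 1)² ε / α` with probability at least `98 / 100`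
(`norm_gram_sub_le_of_cost_le`, `gramError_prob`). It remains to show that such a sketch needs
`m ≳ n / η` rows.

Take `k = d / n` disjoint blocks of `n` coordinates, so that `k n ≳ n / η`, and write `M` for the
Gram matrix of the corresponding columns of `S`; its rank is at most `m`. Two kinds of orthonormal
families are tested. The coordinate vectors of a block show that for most coordinates `q` the
diagonal entry `M q q` is at least `1 / 2`, while the part of row `q` inside its own block is
bounded. For the second kind, one vector `e` of a block is replaced by `(e ± v) / √2`, with `v` a
normalized random sign vector supported off the block; subtracting the two guarantees removes the
diagonal terms and yields `∑ l, ⟪S e_l, S v⟫² ≤ 2 η` (`sum_sq_le_of_gramError_tilt_le`). Since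
only finitely many families are involved, one fixed `S` is good for most of them
(`exists_frequency_ge`).

For this `S` the inequality `(tr M_RR)² ≤ m ‖M_RR‖_F²` on sets `R` of coordinates shows that if
`m` is small, then most rows of `M` carry mass `≳ k n / m` outside their own block
(`card_light_rows_le`). By the second and fourth moments of sign sums, `⟪S e_l, S v⟫²` is then
`≳ 1 / m` for a constant fraction of all choices (`card_div_three_le_sum_signs`), so that
`n / m ≲ η` (`le_of_good_blocks`).
-/

namespace RidgeSketch

open Finset

/-! ### Moments of random signs and the Frobenius norm of a Gram matrix -/

/-- Flipping the sign at `i` cancels the terms in pairs. -/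
theorem sum_signs_mul_eq_zero {ι : Type*} [Fintype ι] [DecidableEq ι] (i : ι)
    (g : (ι → ℤˣ) → ℝ) (hg : ∀ e, g (Function.update e i (-e i)) = g e) :
    ∑ e : ι → ℤˣ, ((e i : ℤ) : ℝ) * g e = 0 := by
  have hinv : Function.Involutive fun e : ι → ℤˣ => Function.update e i (-e i) := by
    intro e; simp
  have h := Equiv.sum_comp hinv.toPerm fun e : ι → ℤˣ => ((e i : ℤ) : ℝ) * g e
  simp only [Function.Involutive.coe_toPerm, Function.update_self, hg, Units.val_neg,
    Int.cast_neg, neg_mul, Finset.sum_neg_distrib] at h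
  linarith

theorem sq_sign (x : ℤˣ) : (((x : ℤ) : ℝ)) ^ 2 = 1 := by
  rcases Int.units_eq_one_or x with rfl | rfl <;> simp

/-- The second moment, and Khintchine's bound for the fourth moment, of a sum of random signs. -/
theorem signs_moments {ι : Type*} [Fintype ι] [DecidableEq ι] (a : ι → ℝ) (s : Finset ι) :
    ∑ e : ι → ℤˣ, (∑ i ∈ s, a i * ((e i : ℤ) : ℝ)) ^ 2
        = Fintype.card (ι → ℤˣ) * ∑ i ∈ s, a i ^ 2 ∧
    ∑ e : ι → ℤˣ, (∑ i ∈ s, a i * ((e i : ℤ) : ℝ)) ^ 4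
        ≤ Fintype.card (ι → ℤˣ) * (3 * (∑ i ∈ s, a i ^ 2) ^ 2) := by
  induction s using Finset.induction_on with
  | empty => simp
  | insert i s hi ih =>
    obtain ⟨ih2, ih4⟩ := ih
    set F : (ι → ℤˣ) → ℝ := fun e => ∑ i ∈ s, a i * ((e i : ℤ) : ℝ) with hF
    have hinv : ∀ e, F (Function.update e i (-e i)) = F e := by
      intro e
      refine Finset.sum_congr rfl fun j hj => ?_
      rw [Function.update_of_ne (ne_of_mem_of_not_mem hj hi)]
    have h1 := sum_signs_mul_eq_zero i F hinv
    have h3 := sum_signs_mul_eq_zero i (fun e => F e ^ 3) (fun e => by simp only [hinv])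
    have e2 : ∀ e : ι → ℤˣ, (∑ l ∈ insert i s, a l * ((e l : ℤ) : ℝ)) ^ 2
        = a i ^ 2 + F e ^ 2 + 2 * a i * (((e i : ℤ) : ℝ) * F e) := by
      intro e
      rw [Finset.sum_insert hi]
      linear_combination (a i) ^ 2 * sq_sign (e i)
    have e4 : ∀ e : ι → ℤˣ, (∑ l ∈ insert i s, a l * ((e l : ℤ) : ℝ)) ^ 4
        = a i ^ 4 + 6 * a i ^ 2 * F e ^ 2 + F e ^ 4 + 4 * a i ^ 3 * (((e i : ℤ) : ℝ) * F e)
          + 4 * a i * (((e i : ℤ) : ℝ) * F e ^ 3) := by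
      intro e
      rw [Finset.sum_insert hi]
      change (_ + F e) ^ 4 = _
      linear_combination (a i ^ 4 * (((e i : ℤ) : ℝ) ^ 2 + 1) + 6 * a i ^ 2 * F e ^ 2
        + 4 * a i ^ 3 * F e * ((e i : ℤ) : ℝ)) * sq_sign (e i)
    change ∑ e, F e ^ 2 = _ at ih2
    change ∑ e, F e ^ 4 ≤ _ at ih4
    rw [Finset.sum_congr rfl fun e _ => e2 e, Finset.sum_congr rfl fun e _ => e4 e,
      Finset.sum_insert hi]
    simp only [Finset.sum_add_distrib, ← Finset.mul_sum, h1, h3, ih2, Finset.sum_const,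
      Finset.card_univ, nsmul_eq_mul]
    set c : ℝ := (Fintype.card (ι → ℤˣ) : ℝ)
    have hc : 0 ≤ c := Nat.cast_nonneg _
    constructor
    · ring
    · nlinarith [mul_nonneg hc (sq_nonneg (a i ^ 2))]

/-- With `Y` the square of a sign sum divided by its variance `∑ a i ^ 2`, the mean of
`2 / 3 * Y - Y ^ 2 / 9` is at least `1 / 3`, because `Y` has mean `1` and second moment at most `3`.
As `2 / 3 * y - y ^ 2 / 9 ≤ min 1 (2 / 3 * y)` for `0 ≤ y`, this is an anti-concentration statement
for `Y` that needs no indicator functions. -/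
theorem card_div_three_le_sum_signs {ι : Type*} [Fintype ι] [DecidableEq ι] (a : ι → ℝ)
    (s : Finset ι) (hs : 0 < ∑ i ∈ s, a i ^ 2) :
    (Fintype.card (ι → ℤˣ) : ℝ) / 3 ≤ ∑ e : ι → ℤˣ,
      (2 / 3 * ((∑ i ∈ s, a i * ((e i : ℤ) : ℝ)) ^ 2 / ∑ i ∈ s, a i ^ 2)
        - ((∑ i ∈ s, a i * ((e i : ℤ) : ℝ)) ^ 2 / ∑ i ∈ s, a i ^ 2) ^ 2 / 9) := by
  obtain ⟨h2, h4⟩ := signs_moments a s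
  set σ := ∑ i ∈ s, a i ^ 2
  simp only [Finset.sum_sub_distrib, ← Finset.mul_sum, ← Finset.sum_div, h2, div_pow, ← pow_mul]
  norm_num
  have h5 : (∑ e : ι → ℤˣ, (∑ i ∈ s, a i * ((e i : ℤ) : ℝ)) ^ 4) / σ ^ 2
      ≤ Fintype.card (ι → ℤˣ) * 3 := by
    rw [div_le_iff₀ (by positivity)]; linarith
  have h6 : (Fintype.card (ι → ℤˣ) : ℝ) * σ / σ = Fintype.card (ι → ℤˣ) := by field_simp
  simp only [Fintype.card_pi, prod_const, card_univ, Fintype.card_units_int, Nat.cast_pow,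
    Nat.cast_ofNat] at h5 h6
  rw [h6]
  linarith

/-- A Gram matrix of vectors in `Fin m → ℝ` has rank at most `m`, so the square of its trace is at
most `m` times the square of its Frobenius norm. Both quantities are those of the `m × m` matrix
`∑ q ∈ R, u q (u q)ᵀ`, for which the bound is Cauchy–Schwarz on the diagonal. -/
theorem sq_sum_dotProduct_self_le {ι : Type*} {m : ℕ} (u : ι → Fin m → ℝ) (R : Finset ι) :
    (∑ q ∈ R, u q ⬝ᵥ u q) ^ 2 ≤ m * ∑ p ∈ R, ∑ q ∈ R, (u p ⬝ᵥ u q) ^ 2 := by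
  let B : Fin m → Fin m → ℝ := fun l l' => ∑ q ∈ R, u q l * u q l'
  have h1 : ∑ q ∈ R, u q ⬝ᵥ u q = ∑ l, B l l := by
    simp only [dotProduct, B]; exact Finset.sum_comm
  have h2 : ∑ p ∈ R, ∑ q ∈ R, (u p ⬝ᵥ u q) ^ 2 = ∑ l, ∑ l', B l l' ^ 2 := by
    simp only [dotProduct, B, sq, Finset.sum_mul_sum]
    simp only [← Finset.sum_product']
    refine Finset.sum_nbij' (fun x => (x.2.2.1, x.2.2.2, x.1, x.2.1))
      (fun x => (x.2.2.1, x.2.2.2, x.1, x.2.1)) ?_ ?_ ?_ ?_ ?_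
    · simp +contextual
    · simp +contextual
    · simp
    · simp
    · intros; ring
  rw [h1, h2]
  calc (∑ l, B l l) ^ 2 ≤ (Finset.univ : Finset (Fin m)).card * ∑ l, B l l ^ 2 :=
        sq_sum_le_card_mul_sum_sq
    _ ≤ m * ∑ l, ∑ l', B l l' ^ 2 := by
        rw [Finset.card_univ, Fintype.card_fin]
        gcongr with l
        exact Finset.single_le_sum (f := fun l' => B l l' ^ 2) (fun _ _ => sq_nonneg _)
          (Finset.mem_univ l)

/-! ### Gram matrices that are nearly the identity on random test families -/

theorem sum_block {k n : ℕ} (f : Fin k × Fin n → ℝ) (a : Fin k) :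
    ∑ i with i.1 = a, f i = ∑ j, f (a, j) := by
  rw [Finset.sum_filter, Fintype.sum_prod_type, Finset.sum_eq_single a]
  · simp
  · intro b _ hb; simp [hb]
  · simp

/-- Few rows of the Gram matrix are light outside their own block: on a set `R` of light rows the
trace is at least `#R / 2`, while the squared Frobenius norm is at most `#R * (9 / 4 + τ)`. -/
theorem card_light_rows_le {k n m : ℕ} (u : Fin k × Fin n → Fin m → ℝ)
    (R : Finset (Fin k × Fin n)) (X τ : ℝ) (hmX : (m : ℝ) ≤ X) (hτ : 0 ≤ τ)
    (hdiag : ∀ q ∈ R, 1 / 2 ≤ u q ⬝ᵥ u q)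
    (hblock : ∀ q ∈ R, ∑ j, (u q ⬝ᵥ u (q.1, j)) ^ 2 ≤ 9 / 4)
    (hlight : ∀ q ∈ R, ∑ i with i.1 ≠ q.1, (u q ⬝ᵥ u i) ^ 2 ≤ τ) :
    (#R : ℝ) ≤ 4 * X * (9 / 4 + τ) := by
  have hX : 0 ≤ X := (Nat.cast_nonneg m).trans hmX
  rcases R.eq_empty_or_nonempty with rfl | hne
  · simp; positivity
  have hR : (0 : ℝ) < #R := by exact_mod_cast hne.card_pos
  have hrow : ∀ q ∈ R, ∑ i ∈ R, (u q ⬝ᵥ u i) ^ 2 ≤ 9 / 4 + τ := by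
    intro q hq
    calc ∑ i ∈ R, (u q ⬝ᵥ u i) ^ 2 ≤ ∑ i, (u q ⬝ᵥ u i) ^ 2 :=
          Finset.sum_le_univ_sum_of_nonneg fun _ => sq_nonneg _
      _ = ∑ i with i.1 = q.1, (u q ⬝ᵥ u i) ^ 2 + ∑ i with i.1 ≠ q.1, (u q ⬝ᵥ u i) ^ 2 :=
          (Finset.sum_filter_add_sum_filter_not _ _ _).symm
      _ ≤ 9 / 4 + τ := by
          rw [sum_block]
          exact add_le_add (hblock q hq) (hlight q hq)
  have hdiag' : (#R : ℝ) * (1 / 2) ≤ ∑ q ∈ R, u q ⬝ᵥ u q := by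
    rw [← nsmul_eq_mul]; exact Finset.card_nsmul_le_sum _ _ _ hdiag
  have hfrob : ∑ p ∈ R, ∑ q ∈ R, (u p ⬝ᵥ u q) ^ 2 ≤ #R * (9 / 4 + τ) := by
    rw [← nsmul_eq_mul]; exact Finset.sum_le_card_nsmul _ _ _ hrow
  have h : ((#R : ℝ) * (1 / 2)) ^ 2 ≤ X * (#R * (9 / 4 + τ)) :=
    (pow_le_pow_left₀ (by positivity) hdiag' 2).trans <|
      (sq_sum_dotProduct_self_le u R).trans <| by gcongr
  have h' : (#R : ℝ) * #R ≤ #R * (4 * X * (9 / 4 + τ)) := by linarith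
  exact le_of_mul_le_mul_left h' hR

/-- The deterministic core. `Q` is the set of coordinates, and `P` the set of pairs of a block and a
sign vector, at which the Gram matrix of `u` behaves like that of a good sketch; together they miss
at most a fraction `6 / 100`. The sum of `2 / 3 * Y - Y ^ 2 / 9` over all heavy rows and all sign
vectors, with `Y` the normalized square of the sign sum of the row outside its block, is bounded
below by anti-concentration and above by `hP` on `P` and by `1` per row off `P`. -/
theorem le_of_good_blocks {k n m : ℕ} (hk : 0 < k) (hn : 0 < n) (u : Fin k × Fin n → Fin m → ℝ)
    (Q : Finset (Fin k × Fin n)) (P : Finset (Fin k × (Fin k × Fin n → ℤˣ))) (η X : ℝ)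
    (hX : 0 < X) (hmX : (m : ℝ) ≤ X) (hXk : 100 * X ≤ (k : ℝ) * n) (hη : 0 ≤ η)
    (hdiag : ∀ q ∈ Q, 1 / 2 ≤ u q ⬝ᵥ u q)
    (hblock : ∀ q ∈ Q, ∑ j, (u q ⬝ᵥ u (q.1, j)) ^ 2 ≤ 9 / 4)
    (hP : ∀ p ∈ P, ∑ l, (∑ i with i.1 ≠ p.1, u (p.1, l) ⬝ᵥ u i * ((p.2 i : ℤ) : ℝ)) ^ 2
      ≤ 2 * η * (k * n))
    (hcard : 194 / 100 ≤ (#Q : ℝ) / Fintype.card (Fin k × Fin n)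
      + (#P : ℝ) / Fintype.card (Fin k × (Fin k × Fin n → ℤˣ))) :
    (n : ℝ) ≤ 1000 * η * X := by
  classical
  set N : ℝ := (k : ℝ) * n with hN
  have hk' : (0 : ℝ) < k := by exact_mod_cast hk
  have hn' : (0 : ℝ) < n := by exact_mod_cast hn
  have hNpos : 0 < N := by positivity
  set E : ℝ := (Fintype.card (Fin k × Fin n → ℤˣ) : ℝ) with hE
  have hEpos : 0 < E := by rw [hE]; exact_mod_cast Fintype.card_pos
  -- this threshold leaves at most `4 * X * (9 / 4 + τ) ≤ 13 / 100 * N` light rows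
  set τ : ℝ := N / (100 * X) with hτ
  have hτpos : 0 < τ := by positivity
  set s : Fin k × Fin n → ℝ := fun q => ∑ i with i.1 ≠ q.1, (u q ⬝ᵥ u i) ^ 2 with hs
  set T : Fin k × Fin n → (Fin k × Fin n → ℤˣ) → ℝ :=
    fun q e => ∑ i with i.1 ≠ q.1, u q ⬝ᵥ u i * ((e i : ℤ) : ℝ) with hT
  set H := Q.filter fun q => τ < s q with hH
  have hQH : (#Q : ℝ) ≤ #H + 13 / 100 * N := by
    have hR := card_light_rows_le u (Q.filter fun q => ¬ τ < s q) X τ hmX hτpos.le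
      (fun q hq => hdiag q (Finset.mem_filter.1 hq).1)
      (fun q hq => hblock q (Finset.mem_filter.1 hq).1)
      (fun q hq => not_lt.1 (Finset.mem_filter.1 hq).2)
    have h1 : (#Q : ℝ) = #H + #(Q.filter fun q => ¬ τ < s q) := by
      exact_mod_cast (Finset.card_filter_add_card_filter_not (s := Q) fun q => τ < s q).symm
    have h2 : X * τ = N / 100 := by rw [hτ]; field_simp
    rw [h1]
    linarith
  -- `f` is a smooth substitute for an indicator: `f y ≤ min 1 (2 / 3 * y)`
  set f : ℝ → ℝ := fun y => 2 / 3 * y - y ^ 2 / 9 with hf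
  have hf1 : ∀ y, f y ≤ 1 := fun y => by simp only [hf]; nlinarith [sq_nonneg (y - 3)]
  have hf2 : ∀ y, f y ≤ 2 / 3 * y := fun y => by simp only [hf]; nlinarith [sq_nonneg y]
  have hlow : (#H : ℝ) * (E / 3) ≤ ∑ q ∈ H, ∑ e, f (T q e ^ 2 / s q) := by
    rw [← nsmul_eq_mul]
    refine Finset.card_nsmul_le_sum _ _ _ fun q hq => ?_
    exact card_div_three_le_sum_signs (fun i => u q ⬝ᵥ u i) _
      (hτpos.trans (Finset.mem_filter.1 hq).2)
  -- the contribution of the block `a` and the sign vector `e`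
  set g : Fin k → (Fin k × Fin n → ℤˣ) → ℝ :=
    fun a e => ∑ l, if (a, l) ∈ H then f (T (a, l) e ^ 2 / s (a, l)) else 0 with hg
  have hsum : ∑ q ∈ H, ∑ e, f (T q e ^ 2 / s q) = ∑ p : Fin k × (Fin k × Fin n → ℤˣ), g p.1 p.2 := by
    rw [Finset.sum_comm, Fintype.sum_prod_type, Finset.sum_comm (s := (univ : Finset (Fin k)))]
    refine Finset.sum_congr rfl fun e _ => ?_
    simp only [hg]
    rw [← Fintype.sum_prod_type' (f := fun a l =>
      if (a, l) ∈ H then f (T (a, l) e ^ 2 / s (a, l)) else 0)]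
    simp
  have hgbad : ∀ p : Fin k × (Fin k × Fin n → ℤˣ), g p.1 p.2 ≤ n := by
    intro p
    calc g p.1 p.2 ≤ ∑ l : Fin n, (1 : ℝ) := by
          refine Finset.sum_le_sum fun l _ => ?_
          split_ifs
          · exact hf1 _
          · exact zero_le_one
      _ = n := by simp
  have hggood : ∀ p ∈ P, g p.1 p.2 ≤ 2 / 3 * (2 * η * N / τ) := by
    intro p hp
    calc g p.1 p.2 ≤ ∑ l : Fin n, 2 / 3 * (T (p.1, l) p.2 ^ 2 / τ) := by
          refine Finset.sum_le_sum fun l _ => ?_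
          split_ifs with hl
          · refine (hf2 _).trans ?_
            have := (Finset.mem_filter.1 hl).2
            gcongr
          · positivity
      _ ≤ 2 / 3 * (2 * η * N / τ) := by
          rw [← Finset.mul_sum, ← Finset.sum_div]
          gcongr
          exact hP p hp
  have hup : ∑ p : Fin k × (Fin k × Fin n → ℤˣ), g p.1 p.2
      ≤ #P * (2 / 3 * (2 * η * N / τ)) + #Pᶜ * (n : ℝ) := by
    rw [← Finset.sum_add_sum_compl P, ← nsmul_eq_mul, ← nsmul_eq_mul]
    exact add_le_add (Finset.sum_le_card_nsmul _ _ _ hggood)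
      (Finset.sum_le_card_nsmul _ _ _ fun p _ => hgbad p)
  have hcQ : ((Fintype.card (Fin k × Fin n) : ℕ) : ℝ) = N := by simp [hN]
  have hcP : ((Fintype.card (Fin k × (Fin k × Fin n → ℤˣ)) : ℕ) : ℝ) = k * E := by
    rw [Fintype.card_prod, Nat.cast_mul, Fintype.card_fin]
  have hPle : (#P : ℝ) ≤ k * E := by rw [← hcP]; exact_mod_cast Finset.card_le_univ P
  have hPc : (#Pᶜ : ℝ) = k * E - #P := by
    rw [← hcP, Finset.card_compl, Nat.cast_sub (Finset.card_le_univ P)]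
  rw [hcQ, hcP] at hcard
  have hval : 2 / 3 * (2 * η * N / τ) = 400 / 3 * (η * X) := by
    rw [hτ]; field_simp; ring
  rw [hval, hPc] at hup
  set x : ℝ := #Q / N with hx
  set y : ℝ := #P / (k * E) with hy
  have hQx : (#Q : ℝ) = x * N := by rw [hx]; field_simp
  have hPy : (#P : ℝ) = y * (k * E) := (div_mul_cancel₀ _ (by positivity)).symm
  have hy1 : y ≤ 1 := by rw [hy]; exact div_le_one_of_le₀ hPle (by positivity)
  have hx1 : x ≤ 1 := by
    rw [hx]; refine div_le_one_of_le₀ ?_ hNpos.le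
    rw [← hcQ]; exact_mod_cast Finset.card_le_univ Q
  have hchain : (x * N - 13 / 100 * N) * (E / 3)
      ≤ y * (k * E) * (400 / 3 * (η * X)) + (k * E - y * (k * E)) * n := by
    rw [← hQx, ← hPy]
    refine le_trans ?_ (hlow.trans (hsum.le.trans hup))
    gcongr
    linarith
  have hchain' : (k * E) * ((x - 13 / 100) / 3 * n)
      ≤ (k * E) * (y * (400 / 3 * (η * X)) + (1 - y) * n) := by
    rw [hN] at hchain
    linarith
  have h1 := le_of_mul_le_mul_left hchain' (by positivity)
  have h2 : y * (400 / 3 * (η * X)) ≤ 400 / 3 * (η * X) :=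
    mul_le_of_le_one_left (by positivity) hy1
  have h3 : 0 ≤ (x + y - 194 / 100) * (n : ℝ) := mul_nonneg (by linarith) hn'.le
  have h4 : 0 ≤ (1 - x) * (n : ℝ) := mul_nonneg (by linarith) hn'.le
  have h5 : 0 ≤ (1 - y) * (n : ℝ) := mul_nonneg (by linarith) hn'.le
  have h6 : 0 ≤ η * X := by positivity
  nlinarith

/-! ### From ridge regression to an approximate isometry -/

theorem borelSpace_matrix (p q : ℕ) : BorelSpace (Matrix (Fin p) (Fin q) ℝ) :=
  inferInstanceAs (BorelSpace (Fin p → Fin q → ℝ))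

theorem regularized_posDef {m n d : ℕ} (S : Matrix (Fin m) (Fin d) ℝ)
    (A : Matrix (Fin n) (Fin d) ℝ) {lam : ℝ} (hlam : 0 < lam) :
    (A * Sᵀ * S * Aᵀ + lam • (1 : Matrix (Fin n) (Fin n) ℝ)).PosDef := by
  have h := Matrix.posSemidef_conjTranspose_mul_self (S * Aᵀ)
  rw [Matrix.conjTranspose_eq_transpose_of_trivial, Matrix.transpose_mul,
    Matrix.transpose_transpose, ← Matrix.mul_assoc] at h
  exact (Matrix.PosDef.one.smul hlam).posSemidef_add h

theorem continuous_sketchedSol {m n d : ℕ} (A : Matrix (Fin n) (Fin d) ℝ)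
    (b : EuclideanSpace ℝ (Fin n)) {lam : ℝ} (hlam : 0 < lam) :
    Continuous fun S : Matrix (Fin m) (Fin d) ℝ => sketchedSol S A b lam := by
  have hP : Continuous fun S : Matrix (Fin m) (Fin d) ℝ =>
      A * Sᵀ * S * Aᵀ + lam • (1 : Matrix (Fin n) (Fin n) ℝ) := by fun_prop
  simp only [sketchedSol, Matrix.toLpLin_apply, Matrix.inv_def, Ring.inverse_eq_inv']
  refine (PiLp.continuous_toLp 2 _).comp (Continuous.matrix_mulVec ?_ continuous_const)
  have hdet := hP.matrix_det.inv₀ fun S => (regularized_posDef S A hlam).det_pos.ne'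
  exact continuous_const.matrix_mul (hdet.smul hP.matrix_adjugate)

theorem measurableSet_cost_sketchedSol_le {m n d : ℕ} (A : Matrix (Fin n) (Fin d) ℝ)
    (b : EuclideanSpace ℝ (Fin n)) {lam : ℝ} (hlam : 0 < lam) (t : ℝ) :
    MeasurableSet {S : Matrix (Fin m) (Fin d) ℝ | cost A b lam (sketchedSol S A b lam) ≤ t} := by
  have := borelSpace_matrix m d
  refine (isClosed_le ?_ continuous_const).measurableSet
  have h := continuous_sketchedSol (m := m) A b hlam
  have hA : Continuous fun x => Matrix.toEuclideanLin A x :=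
    LinearMap.continuous_of_finiteDimensional _
  unfold cost
  have h2 := hA.comp h
  simp only [Function.comp_def] at h2
  fun_prop

theorem measurableSet_specNorm_mul_le {m n d : ℕ} (V : Matrix (Fin d) (Fin n) ℝ) (t : ℝ) :
    MeasurableSet {S : Matrix (Fin m) (Fin d) ℝ | specNorm (S * V) ≤ t} := by
  have := borelSpace_matrix m d
  refine (isClosed_le ?_ continuous_const).measurableSet
  have h1 : Continuous fun M : Matrix (Fin m) (Fin n) ℝ =>
      LinearMap.toContinuousLinearMap (Matrix.toEuclideanLin M) :=
    LinearMap.continuous_of_finiteDimensional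
      (LinearMap.toContinuousLinearMap.toLinearMap ∘ₗ
        (Matrix.toEuclideanLin (𝕜 := ℝ) (m := Fin m) (n := Fin n)).toLinearMap)
  exact (h1.comp (continuous_id.matrix_mul continuous_const)).norm

open scoped Matrix.Norms.L2Operator in
theorem specNorm_eq_norm {p q : ℕ} (M : Matrix (Fin p) (Fin q) ℝ) : specNorm M = ‖M‖ := rfl

open scoped Matrix.Norms.L2Operator in
theorem specNorm_sqrt_smul_transpose {n d : ℕ} (hn : 0 < n) (V : Matrix (Fin d) (Fin n) ℝ)
    (hV : Vᵀ * V = 1) {α : ℝ} (hα : 0 ≤ α) : specNorm (√α • Vᵀ) ^ 2 = α := by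
  have : Nonempty (Fin n) := ⟨⟨0, hn⟩⟩
  have h1 : ‖V‖ * ‖V‖ = 1 := by
    rw [← Matrix.l2_opNorm_conjTranspose_mul_self, Matrix.conjTranspose_eq_transpose_of_trivial, hV]
    exact CStarRing.norm_one
  rw [specNorm_eq_norm, norm_smul, ← Matrix.conjTranspose_eq_transpose_of_trivial,
    Matrix.l2_opNorm_conjTranspose, mul_pow, sq ‖V‖, h1, Real.norm_of_nonneg (Real.sqrt_nonneg _),
    Real.sq_sqrt hα, mul_one]

theorem norm_toEuclideanLin_of_orthonormal {n d : ℕ} (V : Matrix (Fin d) (Fin n) ℝ)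
    (hV : Vᵀ * V = 1) (y : EuclideanSpace ℝ (Fin n)) : ‖Matrix.toEuclideanLin V y‖ = ‖y‖ := by
  rw [← sq_eq_sq₀ (norm_nonneg _) (norm_nonneg _), ← real_inner_self_eq_norm_sq,
    ← LinearMap.adjoint_inner_right, ← Matrix.toEuclideanLin_conjTranspose_eq_adjoint,
    Matrix.conjTranspose_eq_transpose_of_trivial, ← LinearMap.comp_apply,
    ← Matrix.toLpLin_mul_same, hV, Matrix.toLpLin_one, LinearMap.id_apply, real_inner_self_eq_norm_sq]

open scoped Matrix.Norms.L2Operator in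
theorem norm_toEuclideanLin_gram_le {m n : ℕ} (W : Matrix (Fin m) (Fin n) ℝ) {K : ℝ}
    (hW : specNorm W ≤ K) (z : EuclideanSpace ℝ (Fin n)) :
    ‖Matrix.toEuclideanLin (Wᵀ * W) z‖ ≤ K ^ 2 * ‖z‖ := by
  have h := (LinearMap.toContinuousLinearMap (Matrix.toEuclideanLin (Wᵀ * W))).le_opNorm z
  refine h.trans ?_
  gcongr
  rw [specNorm_eq_norm] at hW
  change ‖Wᵀ * W‖ ≤ _
  rw [← Matrix.conjTranspose_eq_transpose_of_trivial, Matrix.l2_opNorm_conjTranspose_mul_self, sq]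
  exact mul_self_le_mul_self (norm_nonneg _) hW

/-- If the sketched solution of the instance `A = √α Vᵀ`, `lam = 1` is nearly optimal and `S` does
not dilate the range of `V`, then the Gram matrix `G` of `S V` nearly fixes `b`. With
`y = (α G + 1)⁻¹ b` the excess cost is a multiple of `‖(α + 1) y - b‖² = ‖α (y - G y)‖²`, and
`b - G b = (α G + 1) (y - G y)`. -/
theorem norm_gram_sub_le_of_cost_le {m n d : ℕ} (V : Matrix (Fin d) (Fin n) ℝ) (hV : Vᵀ * V = 1)
    (S : Matrix (Fin m) (Fin d) ℝ) (b : EuclideanSpace ℝ (Fin n)) {α ε K : ℝ} (hα : 1 ≤ α)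
    (hε : 0 ≤ ε) (hS : specNorm (S * V) ≤ K)
    (hcost : cost (√α • Vᵀ) b 1 (sketchedSol S (√α • Vᵀ) b 1) ≤ (1 + ε) * opt (√α • Vᵀ) b 1) :
    ‖Matrix.toEuclideanLin ((S * V)ᵀ * (S * V)) b - b‖ ^ 2
      ≤ (K ^ 2 + 1) ^ 2 * (ε / α) * ‖b‖ ^ 2 := by
  have hα0 : 0 < α := by linarith
  set G := (S * V)ᵀ * (S * V) with hG
  set L := Matrix.toEuclideanLin G with hL
  set A := √α • Vᵀ with hA
  set P := A * Sᵀ * S * Aᵀ + (1 : ℝ) • (1 : Matrix (Fin n) (Fin n) ℝ) with hP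
  have hPG : P = α • G + 1 := by
    rw [hP, hA, hG, one_smul, Matrix.transpose_smul, Matrix.transpose_transpose, Matrix.transpose_mul]
    simp only [Matrix.smul_mul, Matrix.mul_smul, smul_smul, Real.mul_self_sqrt hα0.le,
      Matrix.mul_assoc]
  set y : EuclideanSpace ℝ (Fin n) := Matrix.toEuclideanLin P⁻¹ b with hy
  have hyb : b = α • L y + y := by
    have h1 : Matrix.toEuclideanLin (P * P⁻¹) b = b := by
      rw [Matrix.mul_nonsing_inv P ((regularized_posDef S A one_pos).det_pos.ne'.isUnit),
        Matrix.toLpLin_one, LinearMap.id_apply]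
    rw [Matrix.toLpLin_mul_same, LinearMap.comp_apply, ← hy, hPG, map_add, map_smul,
      Matrix.toLpLin_one] at h1
    exact h1.symm
  have hAT : ∀ z, Matrix.toEuclideanLin Aᵀ z = √α • Matrix.toEuclideanLin V z := by
    intro z
    rw [hA, Matrix.transpose_smul, Matrix.transpose_transpose, map_smul, LinearMap.smul_apply]
  have hAV : ∀ z, Matrix.toEuclideanLin A (√α • Matrix.toEuclideanLin V z) = α • z := by
    intro z
    rw [hA, map_smul, map_smul, LinearMap.smul_apply, smul_smul, Real.mul_self_sqrt hα0.le,
      ← LinearMap.comp_apply, ← Matrix.toLpLin_mul_same, hV, Matrix.toLpLin_one, LinearMap.id_apply]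
  -- completing the square on the range of `V`; the minimum is at `z = (α + 1)⁻¹ b`
  have hcostV : ∀ z, cost A b 1 (√α • Matrix.toEuclideanLin V z)
      = α / (α + 1) * ‖(α + 1) • z - b‖ ^ 2 + ‖b‖ ^ 2 / (α + 1) := by
    intro z
    rw [cost, hAV, norm_smul, norm_toEuclideanLin_of_orthonormal V hV, mul_pow, Real.norm_eq_abs,
      sq_abs, Real.sq_sqrt hα0.le, norm_sub_sq_real, norm_sub_sq_real, norm_smul, norm_smul,
      real_inner_smul_left, real_inner_smul_left, Real.norm_of_nonneg hα0.le,
      Real.norm_of_nonneg (by linarith : 0 ≤ α + 1)]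
    field_simp
    ring
  have hsol : sketchedSol S A b 1 = √α • Matrix.toEuclideanLin V y := by
    rw [sketchedSol, Matrix.toLpLin_mul_same, LinearMap.comp_apply, hAT]
  have hopt : opt A b 1 ≤ ‖b‖ ^ 2 / (α + 1) := by
    refine (ciInf_le ⟨0, ?_⟩ (√α • Matrix.toEuclideanLin V ((α + 1)⁻¹ • b))).trans ?_
    · rintro _ ⟨x, rfl⟩
      simp only [cost]; positivity
    · rw [hcostV, smul_inv_smul₀ (by linarith)]
      simp
  rw [hsol, hcostV] at hcost
  have h1 : α * ‖(α + 1) • y - b‖ ^ 2 ≤ ε * ‖b‖ ^ 2 := by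
    have h2 : α / (α + 1) * ‖(α + 1) • y - b‖ ^ 2 + ‖b‖ ^ 2 / (α + 1)
        ≤ (1 + ε) * (‖b‖ ^ 2 / (α + 1)) := hcost.trans (by gcongr)
    have h3 : α * ‖(α + 1) • y - b‖ ^ 2 / (α + 1) ≤ ε * ‖b‖ ^ 2 / (α + 1) := by
      rw [mul_div_right_comm, mul_div_assoc]; linarith
    exact (div_le_div_iff_of_pos_right (by linarith)).1 h3
  have h4 : (α + 1) • y - b = α • (y - L y) := by rw [hyb]; module
  have h5 : L b - b = -(α • L (y - L y) + (y - L y)) := by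
    rw [map_sub]; nth_rewrite 1 [hyb]; rw [map_add, map_smul]; nth_rewrite 1 [hyb]; module
  rw [h4, norm_smul, Real.norm_of_nonneg hα0.le] at h1
  have h6 : ‖L b - b‖ ≤ α * (K ^ 2 + 1) * ‖y - L y‖ := by
    rw [h5, norm_neg]
    refine (norm_add_le _ _).trans ?_
    rw [norm_smul, Real.norm_of_nonneg hα0.le]
    have h7 := mul_le_mul_of_nonneg_left (norm_toEuclideanLin_gram_le _ hS (y - L y)) hα0.le
    have h8 := mul_le_mul_of_nonneg_right hα (norm_nonneg (y - L y))
    linarith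
  calc ‖L b - b‖ ^ 2 ≤ (α * (K ^ 2 + 1) * ‖y - L y‖) ^ 2 := by gcongr
    _ = (K ^ 2 + 1) ^ 2 / α * (α * (α * ‖y - L y‖) ^ 2) / 1 := by field_simp
    _ ≤ (K ^ 2 + 1) ^ 2 / α * (ε * ‖b‖ ^ 2) / 1 := by gcongr
    _ = _ := by ring

/-! ### Error events and their probabilities -/

/-- The squared norm of `(G - 1) e_j`, where `G` is the Gram matrix of the sketched family
`S *ᵥ w l`. -/
noncomputable def gramError {m n d : ℕ} (S : Matrix (Fin m) (Fin d) ℝ) (w : Fin n → Fin d → ℝ)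
    (j : Fin n) : ℝ :=
  ∑ l, ((S *ᵥ w l) ⬝ᵥ (S *ᵥ w j) - if l = j then 1 else 0) ^ 2

theorem measurableSet_gramError_le {m n d : ℕ} (w : Fin n → Fin d → ℝ) (j : Fin n) (t : ℝ) :
    MeasurableSet {S : Matrix (Fin m) (Fin d) ℝ | gramError S w j ≤ t} := by
  have := borelSpace_matrix m d
  refine (isClosed_le ?_ continuous_const).measurableSet
  have h : ∀ l, Continuous fun S : Matrix (Fin m) (Fin d) ℝ => S *ᵥ w l := fun l =>
    continuous_id.matrix_mulVec continuous_const
  have h2 : ∀ l, Continuous fun S : Matrix (Fin m) (Fin d) ℝ => (S *ᵥ w l) ⬝ᵥ (S *ᵥ w j) :=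
    fun l => (h l).dotProduct (h j)
  unfold gramError
  fun_prop

theorem measureReal_add_sub_one_le_inter {Ω : Type*} [MeasurableSpace Ω] (μ : Measure Ω)
    [IsProbabilityMeasure μ] (s : Set Ω) {t : Set Ω} (ht : MeasurableSet t) :
    μ.real s + μ.real t - 1 ≤ μ.real (s ∩ t) := by
  have h1 := measureReal_union_add_inter (μ := μ) (s := s) ht
  have h2 : μ.real (s ∪ t) ≤ 1 := measureReal_le_one
  linarith

/-- The ridge guarantee and non-dilation, used for the matrix with columns `w l`, bound the Gram
error of every orthonormal family. -/
theorem gramError_prob {m n d : ℕ} {K α ε : ℝ} (hα : 1 ≤ α) (hε : 0 ≤ ε)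
    (μ : Measure (Matrix (Fin m) (Fin d) ℝ)) [IsProbabilityMeasure μ]
    (hdil : NonDilating n K μ) (hsol : SolvesRidge n α ε μ) (w : Fin n → Fin d → ℝ)
    (hw : ∀ l l', w l ⬝ᵥ w l' = if l = l' then 1 else 0) (j : Fin n) :
    98 / 100 ≤ μ.real {S | gramError S w j ≤ (K ^ 2 + 1) ^ 2 * (ε / α)} := by
  set V : Matrix (Fin d) (Fin n) ℝ := (Matrix.of w)ᵀ with hVdef
  have hV : Vᵀ * V = 1 := by
    ext l l'
    rw [Matrix.one_apply, ← hw l l']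
    rfl
  set b : EuclideanSpace ℝ (Fin n) := EuclideanSpace.single j 1 with hb
  have hA := specNorm_sqrt_smul_transpose (Fin.pos j) V hV (by linarith : 0 ≤ α)
  have h1 := hdil V hV
  have h2 := hsol (√α • Vᵀ) b 1 one_pos (by rw [hA, div_one]; exact hα) (by rw [hA, div_one])
  have h3 := measureReal_add_sub_one_le_inter μ {S | specNorm (S * V) ≤ K}
    (measurableSet_cost_sketchedSol_le (m := m) (√α • Vᵀ) b one_pos ((1 + ε) * opt (√α • Vᵀ) b 1))
  refine le_trans (by linarith) (h3.trans (measureReal_mono ?_))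
  rintro S ⟨hS1, hS2⟩
  have h := norm_gram_sub_le_of_cost_le V hV S b hα hε hS1 hS2
  have hb1 : ‖b‖ = 1 := by rw [hb, PiLp.norm_single, norm_one]
  rw [hb1, one_pow, mul_one, EuclideanSpace.real_norm_sq_eq] at h
  refine le_trans (le_of_eq ?_) h
  refine Finset.sum_congr rfl fun l _ => ?_
  have h4 : (Matrix.toEuclideanLin ((S * V)ᵀ * (S * V)) b - b).ofLp l
      = (((S * V)ᵀ * (S * V)) *ᵥ Pi.single j 1) l - (Pi.single j 1 : Fin n → ℝ) l := rfl
  rw [h4, Matrix.mulVec_single_one, Pi.single_apply]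
  rfl

/-- The family `w` with its member `w j` replaced by `(w j + v) / √2`. -/
noncomputable def tilt {n d : ℕ} (w : Fin n → Fin d → ℝ) (j : Fin n) (v : Fin d → ℝ) :
    Fin n → Fin d → ℝ :=
  Function.update w j ((√2)⁻¹ • (w j + v))

theorem tilt_orthonormal {n d : ℕ} (w : Fin n → Fin d → ℝ)
    (hw : ∀ l l', w l ⬝ᵥ w l' = if l = l' then 1 else 0) (j : Fin n) (v : Fin d → ℝ)
    (hv : v ⬝ᵥ v = 1) (hwv : ∀ l, w l ⬝ᵥ v = 0) (l l' : Fin n) :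
    tilt w j v l ⬝ᵥ tilt w j v l' = if l = l' then 1 else 0 := by
  have hvw : ∀ l, v ⬝ᵥ w l = 0 := fun l => by rw [dotProduct_comm, hwv]
  have h2 : (√2)⁻¹ * (√2)⁻¹ = (2 : ℝ)⁻¹ := by
    rw [← mul_inv, Real.mul_self_sqrt (by norm_num)]
  unfold tilt
  by_cases h : l = j <;> by_cases h' : l' = j
  · subst h h'
    simp only [Function.update_self, smul_dotProduct, dotProduct_smul, add_dotProduct,
      dotProduct_add, hw, hv, hwv, hvw, smul_eq_mul, if_true]
    linear_combination 2 * h2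
  · subst h
    simp [Function.update_of_ne h', add_dotProduct, hw, hvw, Ne.symm h']
  · subst h'
    simp [dotProduct_add, hw, hwv, h]
  · simp [Function.update_of_ne h, Function.update_of_ne h', hw]

/-- Polarization: the errors of the two families tilted by `v` and by `-v` differ only in the terms
that are linear in `v`, so if both are small, the sketch keeps `v` nearly orthogonal to `w`. -/
theorem sum_sq_le_of_gramError_tilt_le {m n d : ℕ} (S : Matrix (Fin m) (Fin d) ℝ)
    (w : Fin n → Fin d → ℝ) (j : Fin n) (v : Fin d → ℝ) {η : ℝ}
    (h1 : gramError S (tilt w j v) j ≤ η) (h2 : gramError S (tilt w j (-v)) j ≤ η) :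
    ∑ l, ((S *ᵥ w l) ⬝ᵥ (S *ᵥ v)) ^ 2 ≤ 2 * η := by
  have h3 : ∑ l, ((S *ᵥ w l) ⬝ᵥ (S *ᵥ v)) ^ 2
      ≤ gramError S (tilt w j v) j + gramError S (tilt w j (-v)) j := by
    rw [gramError, gramError, ← Finset.sum_add_distrib]
    refine Finset.sum_le_sum fun l _ => ?_
    have hs : (√2)⁻¹ * (√2)⁻¹ = (2 : ℝ)⁻¹ := by
      rw [← mul_inv, Real.mul_self_sqrt (by norm_num)]
    by_cases h : l = j
    · subst h
      have hc : (S *ᵥ v) ⬝ᵥ (S *ᵥ w l) = (S *ᵥ w l) ⬝ᵥ (S *ᵥ v) := dotProduct_comm _ _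
      simp only [tilt, Function.update_self, Matrix.mulVec_smul, Matrix.mulVec_add,
        Matrix.mulVec_neg, smul_dotProduct, dotProduct_smul, add_dotProduct, dotProduct_add,
        neg_dotProduct, dotProduct_neg, smul_eq_mul, if_true, hc]
      simp only [mul_add, mul_neg, ← mul_assoc, hs]
      nlinarith [sq_nonneg ((S *ᵥ w l) ⬝ᵥ (S *ᵥ w l) + (S *ᵥ v) ⬝ᵥ (S *ᵥ v) - 2),
        sq_nonneg ((S *ᵥ w l) ⬝ᵥ (S *ᵥ v))]
    · simp only [tilt, Function.update_self, Function.update_of_ne h, Matrix.mulVec_smul,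
        Matrix.mulVec_add, Matrix.mulVec_neg, dotProduct_smul, dotProduct_add, dotProduct_neg,
        smul_eq_mul, if_neg h, sub_zero, mul_pow, inv_pow, Real.sq_sqrt (zero_le_two (α := ℝ))]
      nlinarith [sq_nonneg ((S *ᵥ w l) ⬝ᵥ (S *ᵥ w j))]
  linarith

theorem le_sum_div_card {I : Type*} [Fintype I] [Nonempty I] {f : I → ℝ} {r : ℝ}
    (h : ∀ i, r ≤ f i) : r ≤ (∑ i, f i) / Fintype.card I := by
  rw [le_div_iff₀ (by exact_mod_cast Fintype.card_pos), mul_comm, ← nsmul_eq_mul]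
  exact Finset.card_nsmul_le_sum _ _ _ fun i _ => h i

/-- Some outcome lies in at least the expected proportion of two finite families of events. -/
theorem exists_frequency_ge {Ω I J : Type*} [MeasurableSpace Ω] [Fintype I] [Fintype J] [Nonempty I]
    [Nonempty J] (μ : Measure Ω) [IsProbabilityMeasure μ] (E : I → Set Ω) (F : J → Set Ω)
    (hE : ∀ i, MeasurableSet (E i)) (hF : ∀ j, MeasurableSet (F j)) {p q : ℝ}
    (hp : ∀ i, p ≤ μ.real (E i)) (hq : ∀ j, q ≤ μ.real (F j)) :
    ∃ ω, ∃ P : Finset I, ∃ Q : Finset J, (∀ i ∈ P, ω ∈ E i) ∧ (∀ j ∈ Q, ω ∈ F j) ∧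
      p + q ≤ (#P : ℝ) / Fintype.card I + (#Q : ℝ) / Fintype.card J := by
  classical
  have hiE : ∀ i, Integrable ((E i).indicator (1 : Ω → ℝ)) μ := fun i =>
    (integrable_const (1 : ℝ)).indicator (hE i)
  have hiF : ∀ j, Integrable ((F j).indicator (1 : Ω → ℝ)) μ := fun j =>
    (integrable_const (1 : ℝ)).indicator (hF j)
  have hi1 : Integrable (fun ω => (∑ i, (E i).indicator (1 : Ω → ℝ) ω) / Fintype.card I) μ :=
    (integrable_finsetSum _ fun i _ => hiE i).div_const _
  have hi2 : Integrable (fun ω => (∑ j, (F j).indicator (1 : Ω → ℝ) ω) / Fintype.card J) μ :=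
    (integrable_finsetSum _ fun i _ => hiF i).div_const _
  obtain ⟨ω, hω⟩ := exists_integral_le (hi1.add hi2)
  refine ⟨ω, univ.filter fun i => ω ∈ E i, univ.filter fun j => ω ∈ F j, by simp, by simp, ?_⟩
  have e1 := le_sum_div_card hp
  have e2 := le_sum_div_card hq
  simp only [Pi.add_apply] at hω
  rw [integral_add hi1 hi2, integral_div, integral_div,
    integral_finsetSum _ fun i _ => hiE i, integral_finsetSum _ fun i _ => hiF i] at hω
  simp only [integral_indicator_one, hE, hF] at hω
  simp only [Set.indicator_apply, Pi.one_apply, Finset.sum_boole] at hω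
  linarith

/-! ### The test families and the lower bound -/

theorem single_dotProduct_single_of_injective {I : Type*} [DecidableEq I] {d : ℕ} {f : I → Fin d}
    (hf : Function.Injective f) (p q : I) :
    (Pi.single (f p) 1 : Fin d → ℝ) ⬝ᵥ Pi.single (f q) 1 = if p = q then 1 else 0 := by
  simp [Pi.single_apply, hf.eq_iff, eq_comm]

/-- The unit vector with signs `e` and equal absolute values on the coordinates outside the block
`a`; `f` embeds the `k` blocks of `n` coordinates into `Fin d`. -/
noncomputable def offBlockSign {k n d : ℕ} (f : Fin k × Fin n → Fin d) (a : Fin k)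
    (e : Fin k × Fin n → ℤˣ) : Fin d → ℝ :=
  (√(#{i : Fin k × Fin n | i.1 ≠ a}))⁻¹ •
    ∑ i with i.1 ≠ a, ((e i : ℤ) : ℝ) • (Pi.single (f i) 1 : Fin d → ℝ)

theorem offBlockSign_dotProduct_self {k n d : ℕ} {f : Fin k × Fin n → Fin d}
    (hf : Function.Injective f) (a : Fin k) (e : Fin k × Fin n → ℤˣ)
    (hD : 0 < #{i : Fin k × Fin n | i.1 ≠ a}) :
    offBlockSign f a e ⬝ᵥ offBlockSign f a e = 1 := by
  have hD' : (0 : ℝ) < #{i : Fin k × Fin n | i.1 ≠ a} := by exact_mod_cast hD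
  rw [offBlockSign, smul_dotProduct, dotProduct_smul, sum_dotProduct]
  simp only [dotProduct_sum, smul_dotProduct, dotProduct_smul,
    single_dotProduct_single_of_injective hf, smul_eq_mul, mul_ite, mul_one, mul_zero,
    Finset.sum_ite_eq]
  rw [Finset.sum_congr rfl (g := fun _ => (1 : ℝ)), Finset.sum_const, nsmul_eq_mul, mul_one,
    ← mul_assoc, ← mul_inv, Real.mul_self_sqrt hD'.le, inv_mul_cancel₀ hD'.ne']
  intro i hi
  rw [if_pos hi, ← sq, sq_sign]

theorem single_dotProduct_offBlockSign {k n d : ℕ} {f : Fin k × Fin n → Fin d}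
    (hf : Function.Injective f) (a : Fin k) (e : Fin k × Fin n → ℤˣ) (l : Fin n) :
    (Pi.single (f (a, l)) 1 : Fin d → ℝ) ⬝ᵥ offBlockSign f a e = 0 := by
  rw [offBlockSign, dotProduct_smul, dotProduct_sum, Finset.sum_eq_zero, smul_zero]
  intro i hi
  rw [dotProduct_smul, single_dotProduct_single_of_injective hf, if_neg, smul_zero]
  rintro rfl
  simp at hi

/-- A random sketch with Gram error at most `η` on every orthonormal family of size `n`, with
probability `98 / 100` each, satisfies `n ≤ 1000 * η * X` for every bound `X` on its number of rows
that is at most a hundredth of the number of coordinates available. -/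
theorem le_of_gramError_prob {k n m d : ℕ} (hk : 2 ≤ k) (hn : 0 < n) (f : Fin k × Fin n → Fin d)
    (hf : Function.Injective f) (μ : Measure (Matrix (Fin m) (Fin d) ℝ)) [IsProbabilityMeasure μ]
    {η X : ℝ} (hη : 0 ≤ η) (hη4 : η ≤ 1 / 4) (hX : 0 < X) (hmX : (m : ℝ) ≤ X)
    (hXk : 100 * X ≤ (k : ℝ) * n)
    (hprob : ∀ w : Fin n → Fin d → ℝ, (∀ l l', w l ⬝ᵥ w l' = if l = l' then 1 else 0) →
      ∀ j, 98 / 100 ≤ μ.real {S | gramError S w j ≤ η}) :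
    (n : ℝ) ≤ 1000 * η * X := by
  have hk0 : 0 < k := by omega
  have : Nonempty (Fin k) := ⟨⟨0, hk0⟩⟩
  have : Nonempty (Fin n) := ⟨⟨0, hn⟩⟩
  have : NeZero n := ⟨hn.ne'⟩
  set w : Fin k → Fin n → Fin d → ℝ := fun a l => Pi.single (f (a, l)) 1 with hwdef
  have hw : ∀ a l l', w a l ⬝ᵥ w a l' = if l = l' then 1 else 0 := by
    intro a l l'
    rw [hwdef, single_dotProduct_single_of_injective hf]
    simp
  have hD : ∀ a, 0 < #{i : Fin k × Fin n | i.1 ≠ a} := by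
    intro a
    have : Nontrivial (Fin k) := Fin.nontrivial_iff_two_le.2 hk
    obtain ⟨b, hb⟩ := exists_ne a
    exact Finset.card_pos.2 ⟨(b, 0), by simpa using hb⟩
  have hv : ∀ a e, offBlockSign f a e ⬝ᵥ offBlockSign f a e = 1 := fun a e =>
    offBlockSign_dotProduct_self hf a e (hD a)
  have hwv : ∀ a e l, w a l ⬝ᵥ offBlockSign f a e = 0 := fun a e l =>
    single_dotProduct_offBlockSign hf a e l
  obtain ⟨S, Q, P, hQ, hP, hcard⟩ := exists_frequency_ge μ (p := 98 / 100) (q := 96 / 100)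
    (fun q : Fin k × Fin n => {S | gramError S (w q.1) q.2 ≤ η})
    (fun p : Fin k × (Fin k × Fin n → ℤˣ) =>
      {S | gramError S (tilt (w p.1) 0 (offBlockSign f p.1 p.2)) 0 ≤ η} ∩
      {S | gramError S (tilt (w p.1) 0 (-offBlockSign f p.1 p.2)) 0 ≤ η})
    (fun q => measurableSet_gramError_le _ _ _)
    (fun p => (measurableSet_gramError_le _ _ _).inter (measurableSet_gramError_le _ _ _))
    (fun q => hprob _ (hw q.1) _)
    (fun p => by
      have h1 := hprob _ (tilt_orthonormal _ (hw p.1) 0 _ (hv p.1 p.2) (hwv p.1 p.2)) 0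
      have h2 := hprob _ (tilt_orthonormal _ (hw p.1) 0 (-offBlockSign f p.1 p.2)
        (by rw [neg_dotProduct_neg, hv]) (fun l => by rw [dotProduct_neg, hwv, neg_zero])) 0
      have h3 := measureReal_add_sub_one_le_inter μ
        {S | gramError S (tilt (w p.1) 0 (offBlockSign f p.1 p.2)) 0 ≤ η}
        (measurableSet_gramError_le (tilt (w p.1) 0 (-offBlockSign f p.1 p.2)) 0 η)
      linarith)
  set u : Fin k × Fin n → Fin m → ℝ := fun q => S *ᵥ Pi.single (f q) 1 with hu
  -- the error is at most `1 / 4`, which pins the diagonal entry to `[1 / 2, 3 / 2]`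
  have hQ' : ∀ q ∈ Q, 1 / 2 ≤ u q ⬝ᵥ u q ∧ ∑ j, (u q ⬝ᵥ u (q.1, j)) ^ 2 ≤ 9 / 4 := by
    rintro ⟨a, j⟩ hq
    have h : gramError S (w a) j ≤ η := hQ (a, j) hq
    have h1 : gramError S (w a) j
        = ∑ l, (u (a, j) ⬝ᵥ u (a, l) - if l = j then 1 else 0) ^ 2 := by
      refine Finset.sum_congr rfl fun l _ => ?_
      rw [dotProduct_comm]
    have h2 : (u (a, j) ⬝ᵥ u (a, j) - 1) ^ 2 ≤ 1 / 4 := by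
      have h3 := Finset.single_le_sum (s := univ)
        (f := fun l => (u (a, j) ⬝ᵥ u (a, l) - if l = j then 1 else 0) ^ 2)
        (fun _ _ => sq_nonneg _) (Finset.mem_univ j)
      simp only [if_true] at h3
      linarith
    have h4 : ∑ l, (u (a, j) ⬝ᵥ u (a, l)) ^ 2
        = gramError S (w a) j + (2 * (u (a, j) ⬝ᵥ u (a, j)) - 1) := by
      have h5 : 2 * (u (a, j) ⬝ᵥ u (a, j)) - 1
          = ∑ l, if l = j then 2 * (u (a, j) ⬝ᵥ u (a, l)) - 1 else 0 := by simp
      rw [h1, h5, ← Finset.sum_add_distrib]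
      refine Finset.sum_congr rfl fun l _ => ?_
      split_ifs <;> ring
    have h6 := abs_le_of_sq_le_sq' (by linarith : (u (a, j) ⬝ᵥ u (a, j) - 1) ^ 2 ≤ (1 / 2) ^ 2)
      (by norm_num)
    refine ⟨by linarith [h6.1], ?_⟩
    change ∑ l, (u (a, j) ⬝ᵥ u (a, l)) ^ 2 ≤ 9 / 4
    rw [h4]
    linarith [h6.2]
  refine le_of_good_blocks hk0 hn u Q P η X hX hmX hXk hη (fun q hq => (hQ' q hq).1)
    (fun q hq => (hQ' q hq).2) ?_ (by linarith)
  rintro ⟨a, e⟩ hp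
  have hPa := hP (a, e) hp
  have h := sum_sq_le_of_gramError_tilt_le S (w a) 0 (offBlockSign f a e) hPa.1 hPa.2
  set D : ℝ := ((#{i : Fin k × Fin n | i.1 ≠ a} : ℕ) : ℝ) with hDdef
  have hDpos : 0 < D := by rw [hDdef]; exact_mod_cast hD a
  have hDle : D ≤ k * n := by
    rw [hDdef]
    exact_mod_cast (Finset.card_le_univ _).trans (by simp)
  have h1 : ∀ l, (S *ᵥ w a l) ⬝ᵥ (S *ᵥ offBlockSign f a e)
      = (√D)⁻¹ * ∑ i with i.1 ≠ a, u (a, l) ⬝ᵥ u i * ((e i : ℤ) : ℝ) := by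
    intro l
    rw [offBlockSign, Matrix.mulVec_smul, Matrix.mulVec_sum, dotProduct_smul, dotProduct_sum,
      smul_eq_mul]
    congr 1
    refine Finset.sum_congr rfl fun i _ => ?_
    rw [Matrix.mulVec_smul, dotProduct_smul, smul_eq_mul, mul_comm]
  simp only [h1, mul_pow, inv_pow, Real.sq_sqrt hDpos.le, ← Finset.mul_sum] at h
  rw [inv_mul_le_iff₀ hDpos] at h
  calc _ ≤ D * (2 * η) := h
    _ ≤ (k * n) * (2 * η) := by gcongr
    _ = _ := by ring

theorem sketch_rows_lower_bound {K : ℝ} {n m d : ℕ} {α ε : ℝ} (hα : 1 ≤ α) (hε : 0 < ε)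
    (hεα : ε ≤ 1 / (4 * (K ^ 2 + 1) ^ 2) * α) (hd : (n : ℝ) * α / ε ≤ d)
    (μ : Measure (Matrix (Fin m) (Fin d) ℝ)) [IsProbabilityMeasure μ]
    (hdil : NonDilating n K μ) (hsol : SolvesRidge n α ε μ) :
    1 / (2000 * (K ^ 2 + 1) ^ 2) * (n * α / ε) ≤ m := by
  have hα0 : 0 < α := by linarith
  rcases Nat.eq_zero_or_pos n with rfl | hn
  · simp
  have hn' : (0 : ℝ) < n := by exact_mod_cast hn
  set C : ℝ := (K ^ 2 + 1) ^ 2 with hC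
  have hC1 : 1 ≤ C := one_le_pow₀ (by nlinarith [sq_nonneg K])
  have hρ : 4 * C ≤ α / ε := by
    rw [le_div_iff₀ hε]
    calc 4 * C * ε ≤ 4 * C * (1 / (4 * C) * α) := by gcongr
      _ = α := by field_simp
  set ρ : ℝ := α / ε with hρdef
  have hερ : ε / α = 1 / ρ := by rw [hρdef, one_div_div]
  rw [mul_div_assoc, ← hρdef] at hd ⊢
  -- otherwise `X = n * ρ / (2000 * C)` bounds `m`, and `1000 * η * X = n / 2` for `η = C / ρ`
  by_contra! hlt
  set k := d / n with hk
  -- the number of disjoint blocks of `n` coordinates that fit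
  have hkρ : ρ / 2 ≤ k := by
    have h1 : (d : ℝ) < n * (k + 1) := by
      exact_mod_cast Nat.lt_mul_div_succ d hn
    have h2 : ρ < k + 1 := lt_of_mul_lt_mul_left (hd.trans_lt h1) hn'.le
    linarith
  have hk2 : 2 ≤ k := by
    have : (2 : ℝ) ≤ k := by linarith
    exact_mod_cast this
  have hf : Function.Injective
      (fun q : Fin k × Fin n => Fin.castLE (Nat.div_mul_le_self d n) (finProdFinEquiv q)) :=
    (Fin.castLE_injective _).comp finProdFinEquiv.injective
  have hX : 0 < 1 / (2000 * C) * (n * ρ) := by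
    have : 0 < ρ := by linarith
    positivity
  have hη4 : C * (ε / α) ≤ 1 / 4 := by
    rw [hερ, mul_one_div, div_le_iff₀ (by linarith)]
    linarith
  have hXk : 100 * (1 / (2000 * C) * (n * ρ)) ≤ (k : ℝ) * n := by
    have h1 : 1 / (2000 * C) ≤ 1 / 2000 := one_div_le_one_div_of_le (by norm_num) (by linarith)
    have h2 : 0 ≤ n * ρ := by have : 0 < ρ := by linarith
                              positivity
    have h3 := mul_le_mul_of_nonneg_right h1 h2
    have h4 := mul_le_mul_of_nonneg_right hkρ hn'.le
    linarith
  have h := le_of_gramError_prob hk2 hn _ hf μ (by positivity) hη4 hX hlt.le hXk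
    fun w hw j => gramError_prob hα hε.le μ hdil hsol w hw j
  have h2 : 1000 * (C * (ε / α)) * (1 / (2000 * C) * (n * ρ)) = n / 2 := by
    have : ρ ≠ 0 := by linarith
    rw [hερ]; field_simp; norm_num
  linarith

end RidgeSketch

theorem mainTheorem2 :
    ∀ K : ℝ, 0 < K → ∃ ε₀ : ℝ, 0 < ε₀ ∧ ∃ c : ℝ, 0 < c ∧
      ∀ (n m d : ℕ) (α ε : ℝ), 1 ≤ α → 0 < ε → ε ≤ ε₀ * α → (n : ℝ) * α / ε ≤ (d : ℝ) →
      ∀ μ : Measure (Matrix (Fin m) (Fin d) ℝ), IsProbabilityMeasure μ →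
        RidgeSketch.NonDilating n K μ → RidgeSketch.SolvesRidge n α ε μ →
        c * ((n : ℝ) * α / ε) ≤ (m : ℝ) ∧
        ∀ (A : Matrix (Fin n) (Fin d) ℝ) (lam : ℝ), 0 < lam →
          1 ≤ RidgeSketch.specNorm A ^ 2 / lam → RidgeSketch.specNorm A ^ 2 / lam ≤ α →
          c * ((n : ℝ) * RidgeSketch.specNorm A ^ 2 / (lam * ε)) ≤ (m : ℝ) := by
  intro K _
  refine ⟨1 / (4 * (K ^ 2 + 1) ^ 2), by positivity, 1 / (2000 * (K ^ 2 + 1) ^ 2), by positivity, ?_⟩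
  intro n m d α ε hα hε hεα hd μ hμ hdil hsol
  have h := RidgeSketch.sketch_rows_lower_bound hα hε hεα hd μ hdil hsol
  refine ⟨h, fun A lam _ _ hA => le_trans ?_ h⟩
  have hσ : (n : ℝ) * RidgeSketch.specNorm A ^ 2 / (lam * ε)
      = n * (RidgeSketch.specNorm A ^ 2 / lam) / ε := by rw [← div_div, mul_div_assoc]
  rw [hσ]
  gcongr
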